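/- Let $d\ge 2$. A domain is a non-empty connected open set; $B_r(p)$ is the open ball in $\mathbb R^d$. A classical superharmonic function on an open set $U\subset\mathbb R^d$ is a lower semicontinuous function $\phi:U\to(-\infty,+\infty]$, not identically $+\infty$ on any connected component of $U$, with $\phi(x)\ge |B_r(x)|^{-1}\int_{B_r(x)}\phi\,dy$ whenever $\overline{B_r(x)}\subset U$, $r>0$. For a domain $\Omega\subset\mathbb R^d$, $p\in\partial\Omega$, $r>0$ and $x\in\Omega\cap B_r(p)$, let $w(x,p,r)$ be the harmonic measure of $\Omega\cap\partial B_r(p)$ over $U=\Omega\cap B_r(p)$, that is, the Perron–Wiener–Brelot solution $$w(x,p,r)=\inf\Big\{\phi(x):\ \phi\text{ classical superharmonic on }U,\ \liminf_{y\to z,\,y\in U}\phi(y)\ge 1_{\Omega\cap\partial B_r(p)}(z)\ \text{ for all } z\in\partial U\Big\}.$$ For $\alpha>0$, $\Omega$ satisfies $\mathbf{LHMD}(\alpha)$ with constant $M>0$ if $$w(x,p,r)\le M\Big(\frac{|x-p|}{r}\Big)^{\alpha}\quad\text{for all } p\in\partial\Omega,\ r>0,\ x\in\Omega\cap B_r(p),$$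 and $\Omega$ satisfies $\mathbf{LHMD}(\alpha)$ if this holds for some $M>0$. For $R>0$ let $\delta_\Omega(R)$ be the infimum of all $\delta\in[0,1]$ such that for every $p\in\partial\Omega$ and every connected component $\Omega'$ of $\Omega\cap B_R(p)$ there is a unit vector $e$ with $\Omega'\subset\{x\in B_R(p):(x-p)\cdot e<\delta R\}$. For $\delta\in[0,1]$, $\Omega$ satisfies the totally $\delta$-exterior Reifenberg condition $\langle\mathrm{TER}\rangle_\delta$ if there are constants $0<R_0\le R_\infty<\infty$ such that $\delta_\Omega(R)\le\delta$ whenever $0<R\le R_0$ or $R\ge R_\infty$. **Theorem.** For every $d\ge2$ and $\epsilon\in(0,1)$ there is $\delta\in(0,1]$, depending only on $d$ and $\epsilon$, such that every domain $\Omega\subset\mathbb R^d$ satisfying $\langle\mathrm{TER}\rangle_\delta$ satisfies $\mathbf{LHMD}(1-\epsilon)$. Moreover, the constant $M$ in $\mathbf{LHMD}(1-\epsilon)$ can be chosen to depend only on $d$, $\epsilon$, $\delta$ and $R_0/R_\infty$, where $R_0,R_\infty$ are the constants in $\langle\mathrm{TER}\rangle_\delta$. -/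

import Mathlib

open MeasureTheory Filter Topology
open scoped ENNReal

namespace HarmonicDecay

/-- `φ` is a classical superharmonic function on the open set `U`: it takes values in `(-∞, +∞]`,
is lower semicontinuous, dominates its mean over every ball whose closure lies in `U`, and is not
identically `+∞` on any connected component of `U`. Only the values of `φ` on `U` matter.
The mean of the extended real function is the mean of its positive part minus the mean of its
negative part; the latter is finite because a lower semicontinuous function with values in
`(-∞, +∞]` is bounded below on compact sets. -/
structure IsClassicalSuperharmonicOn {d : ℕ} (φ : EuclideanSpace ℝ (Fin d) → EReal)
    (U : Set (EuclideanSpace ℝ (Fin d))) : Prop where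
  ne_bot : ∀ x ∈ U, φ x ≠ ⊥
  lsc : LowerSemicontinuousOn φ U
  mean_le : ∀ x ∈ U, ∀ r : ℝ, 0 < r → Metric.closedBall x r ⊆ U →
    ((⨍⁻ y in Metric.ball x r, (φ y).toENNReal ∂volume : ℝ≥0∞) : EReal)
      - ((⨍⁻ y in Metric.ball x r, (-φ y).toENNReal ∂volume : ℝ≥0∞) : EReal) ≤ φ x
  ne_top : ∀ x ∈ U, ∃ y ∈ connectedComponentIn U x, φ y ≠ ⊤

/-- The Perron-Wiener-Brelot solution of `Δu = 0` in `U`, `u = F` on `∂U`: the pointwise infimum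
of all classical superharmonic functions `φ` on `U` with `liminf φ(y) ≥ F(z)` as `y → z`, `y ∈ U`,
for all `z ∈ ∂U`. The infimum is taken in the extended reals. -/
noncomputable def pwbSolution {d : ℕ} (U : Set (EuclideanSpace ℝ (Fin d)))
    (F : EuclideanSpace ℝ (Fin d) → ℝ) (x : EuclideanSpace ℝ (Fin d)) : EReal :=
  sInf {t : EReal | ∃ φ : EuclideanSpace ℝ (Fin d) → EReal,
    IsClassicalSuperharmonicOn φ U ∧
    (∀ z ∈ frontier U, (F z : EReal) ≤ liminf φ (𝓝[U] z)) ∧ t = φ x}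

/-- The harmonic measure `w(x, U, E)` of `E ⊆ ∂U` over `U`. -/
noncomputable def harmonicMeasure {d : ℕ} (x : EuclideanSpace ℝ (Fin d))
    (U E : Set (EuclideanSpace ℝ (Fin d))) : EReal :=
  pwbSolution U (E.indicator fun _ => (1 : ℝ)) x

/-- The local harmonic measure `w(x, p, r) = w(x, Ω ∩ B_r(p), Ω ∩ ∂B_r(p))`. -/
noncomputable def localHarmonicMeasure {d : ℕ} (Ω : Set (EuclideanSpace ℝ (Fin d)))
    (x p : EuclideanSpace ℝ (Fin d)) (r : ℝ) : EReal :=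
  harmonicMeasure x (Ω ∩ Metric.ball p r) (Ω ∩ Metric.sphere p r)

/-- The local harmonic measure decay estimate with exponent `α` and constant `M`. -/
def LHMDWith {d : ℕ} (Ω : Set (EuclideanSpace ℝ (Fin d))) (α M : ℝ) : Prop :=
  ∀ p ∈ frontier Ω, ∀ r : ℝ, 0 < r → ∀ x ∈ Ω ∩ Metric.ball p r,
    localHarmonicMeasure Ω x p r ≤ ((M * (dist x p / r) ^ α : ℝ) : EReal)

/-- The local harmonic measure decay property with exponent `α`. -/
def LHMD {d : ℕ} (Ω : Set (EuclideanSpace ℝ (Fin d))) (α : ℝ) : Prop :=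
  ∃ M : ℝ, 0 < M ∧ LHMDWith Ω α M

/-- The set of all `(δ, R) ∈ [0, 1] × (0, ∞)` such that for each boundary point `p`, every connected
component of `Ω ∩ B_R(p)` lies in `{x : (x - p) · e < δ R}` for some unit vector `e`, which may
depend on the component. -/
def ER {d : ℕ} (Ω : Set (EuclideanSpace ℝ (Fin d))) : Set (ℝ × ℝ) :=
  {q | q.1 ∈ Set.Icc (0 : ℝ) 1 ∧ 0 < q.2 ∧
    ∀ p ∈ frontier Ω, ∀ y ∈ Ω ∩ Metric.ball p q.2,
      ∃ e : EuclideanSpace ℝ (Fin d), ‖e‖ = 1 ∧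
        connectedComponentIn (Ω ∩ Metric.ball p q.2) y ⊆
          {x | x ∈ Metric.ball p q.2 ∧ inner ℝ (x - p) e < q.1 * q.2}}

/-- `δ_Ω(R)`, the infimum of all `δ` with `(δ, R) ∈ ER Ω`. -/
noncomputable def extFlatness {d : ℕ} (Ω : Set (EuclideanSpace ℝ (Fin d))) (R : ℝ) : ℝ :=
  sInf {δ : ℝ | (δ, R) ∈ ER Ω}

/-- The totally `δ`-exterior Reifenberg condition with scales `R₀ ≤ R∞`. -/
def TERWith {d : ℕ} (Ω : Set (EuclideanSpace ℝ (Fin d))) (δ R₀ Rinf : ℝ) : Prop :=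
  0 < R₀ ∧ R₀ ≤ Rinf ∧ ∀ R : ℝ, 0 < R → (R ≤ R₀ ∨ Rinf ≤ R) → extFlatness Ω R ≤ δ

/-- The totally `δ`-exterior Reifenberg condition. -/
def TER {d : ℕ} (Ω : Set (EuclideanSpace ℝ (Fin d))) (δ : ℝ) : Prop :=
  ∃ R₀ Rinf : ℝ, TERWith Ω δ R₀ Rinf

end HarmonicDecay

/-!
The proof bounds the harmonic measure from above by continuous superharmonic functions built scale
by scale.

*One scale.* If `⟪x - p, e⟫ < δ R` on a component of `Ω ∩ B_R(p)`, then with `v = (x - p) / R` and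
`s = δ - ⟪v, e⟫ ∈ (0, 2)` the harmonic polynomial `‖v‖² + d s (2 - s)` is at least `‖v‖²`, so its
boundary values on `∂B_R(p)` are at least `1`, and it is `O(δ + ‖v‖)` near `p` (`exists_barrier`).
For `δ < η` it is at most `(4 d + 1) η` on `B_{ηR}(p)`, and this is at most `η ^ (1 - ε) / 2` once
`η` is small in terms of `d` and `ε`.

*All scales.* The function built at radius `η R`, multiplied by the decay factor of the scale `R`,
is glued by a minimum to the barrier at radius `R` (`IsSupermean.glue`,
`exists_iterated_barrier`). After `k` steps the result is bounded on `B_{η ^ k r}(p)` by the product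
of the factors. The factor is `η ^ (1 - ε)` at scales `R ≤ R₀` and `R ≥ R∞`, and `2`, with the
barrier `1`, at the others; the number of the latter is bounded in terms of `η` and `R₀ / R∞`
(`prod_scale_factors_le`).

*Gluing.* Superharmonicity asks for the mean value inequality on all balls,
while gluing gives it only on small ones. The margin `1 / 2` in the decay factor makes the radius of
these small balls uniform, and continuity together with the inequality at a uniform scale suffices
(`setIntegral_ball_le_of_local`): averaging over the orthogonal group reduces to radial functions,
and a radial function with the local inequality is largest at the centre by the minimum principle.
-/

namespace HarmonicDecay

/-! ### Averages over the orthogonal group -/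

section RadialAverage

variable {E : Type*} [NormedAddCommGroup E] [InnerProductSpace ℝ E] [FiniteDimensional ℝ E]

instance properSpace_endomorphism : ProperSpace (E →L[ℝ] E) := FiniteDimensional.proper ℝ _

instance compactSpace_unitary : CompactSpace (unitary (E →L[ℝ] E)) := by
  have hc : IsClosed ((unitary (E →L[ℝ] E) : Submonoid (E →L[ℝ] E)) : Set (E →L[ℝ] E)) := by
    have : ((unitary (E →L[ℝ] E) : Submonoid (E →L[ℝ] E)) : Set (E →L[ℝ] E))
        = {T | star T * T = 1} ∩ {T | T * star T = 1} := by
      ext T; simp [Unitary.mem_iff]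
    rw [this]
    exact (isClosed_eq (by fun_prop) (by fun_prop)).inter (isClosed_eq (by fun_prop) (by fun_prop))
  refine isCompact_iff_compactSpace.1 ((isCompact_closedBall (0 : E →L[ℝ] E) 1).of_isClosed_subset
    hc fun T hT => ?_)
  simp only [mem_closedBall_zero_iff]
  refine ContinuousLinearMap.opNorm_le_bound _ zero_le_one fun x => ?_
  rw [one_mul]
  exact (ContinuousLinearMap.norm_map_of_mem_unitary hT x).le

theorem exists_unitary_apply_eq {x y : E} (h : ‖x‖ = ‖y‖) :
    ∃ g : unitary (E →L[ℝ] E), (g : E →L[ℝ] E) x = y := by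
  refine ⟨Unitary.linearIsometryEquiv.symm (Submodule.reflection (ℝ ∙ (x - y))ᗮ), ?_⟩
  simpa using Submodule.reflection_sub h

/-- The Haar probability measure on the group of linear isometries of `E`, realised as the compact
group of unitary elements of `E →L[ℝ] E`. -/
noncomputable def haarUnitary : Measure (unitary (E →L[ℝ] E)) := Measure.haarMeasure ⊤

instance : IsProbabilityMeasure (haarUnitary (E := E)) :=
  ⟨by simpa [haarUnitary] using Measure.haarMeasure_self (G := unitary (E →L[ℝ] E)) (K₀ := ⊤)⟩

instance : (haarUnitary (E := E)).IsMulLeftInvariant := by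
  unfold haarUnitary; infer_instance

/-- The average of `u` over all rotations and reflections about the origin, a function of the norm
alone. The inverse in the integrand makes left invariance of the Haar measure sufficient. -/
noncomputable def radialAverage (u : E → ℝ) (y : E) : ℝ :=
  ∫ g, u (((g⁻¹ : unitary (E →L[ℝ] E)) : E →L[ℝ] E) y) ∂haarUnitary

theorem continuous_inv_unitary_apply :
    Continuous fun q : E × unitary (E →L[ℝ] E) =>
      ((q.2⁻¹ : unitary (E →L[ℝ] E)) : E →L[ℝ] E) q.1 := by
  have : Continuous fun q : E × unitary (E →L[ℝ] E) =>
      ((q.2⁻¹ : unitary (E →L[ℝ] E)) : E →L[ℝ] E) :=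
    continuous_subtype_val.comp continuous_snd.inv
  exact this.clm_apply continuous_fst

theorem continuous_radialAverage {u : E → ℝ} (hu : Continuous u) :
    Continuous (radialAverage u) := by
  have := continuous_parametric_integral_of_continuous (μ := haarUnitary (E := E))
    (f := fun y g => u (((g⁻¹ : unitary (E →L[ℝ] E)) : E →L[ℝ] E) y))
    (hu.comp continuous_inv_unitary_apply) isCompact_univ
  simp only [Measure.restrict_univ] at this
  exact this

theorem radialAverage_zero (u : E → ℝ) : radialAverage u 0 = u 0 := by
  simp [radialAverage]

theorem radialAverage_eq_of_norm_eq (u : E → ℝ) {x y : E} (h : ‖x‖ = ‖y‖) :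
    radialAverage u x = radialAverage u y := by
  obtain ⟨g, rfl⟩ := exists_unitary_apply_eq h
  unfold radialAverage
  rw [← integral_mul_left_eq_self
    (fun k : unitary (E →L[ℝ] E) => u (((k⁻¹ : unitary (E →L[ℝ] E)) : E →L[ℝ] E)
      ((g : E →L[ℝ] E) x))) g]
  congr 1
  ext k
  congr 1
  rw [mul_inv_rev]
  change _ = ((k⁻¹ : unitary (E →L[ℝ] E)) : E →L[ℝ] E)
    (((g⁻¹ * g : unitary (E →L[ℝ] E)) : E →L[ℝ] E) x)
  rw [inv_mul_cancel]
  rfl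

variable [MeasurableSpace E] [BorelSpace E]

theorem integrable_uncurry_inv_unitary {u : E → ℝ} (hu : Continuous u) (z : E) (ρ : ℝ) :
    Integrable (Function.uncurry fun (y : E) (g : unitary (E →L[ℝ] E)) =>
      u (((g⁻¹ : unitary (E →L[ℝ] E)) : E →L[ℝ] E) y))
      ((volume.restrict (Metric.ball z ρ)).prod haarUnitary) := by
  have h1 : IntegrableOn (Function.uncurry fun (y : E) (g : unitary (E →L[ℝ] E)) =>
      u (((g⁻¹ : unitary (E →L[ℝ] E)) : E →L[ℝ] E) y))
      (Metric.closedBall z ρ ×ˢ Set.univ) (volume.prod haarUnitary) :=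
    ((hu.comp continuous_inv_unitary_apply).continuousOn).integrableOn_compact
      ((isCompact_closedBall z ρ).prod isCompact_univ)
  have h2 := h1.mono_set (Set.prod_mono_left (t := Set.univ)
    (Metric.ball_subset_closedBall (x := z) (ε := ρ)))
  rwa [IntegrableOn, ← Measure.prod_restrict, Measure.restrict_univ] at h2

theorem setIntegral_ball_comp_unitary (u : E → ℝ) (g : unitary (E →L[ℝ] E)) (z : E) (ρ : ℝ) :
    ∫ y in Metric.ball z ρ, u ((g : E →L[ℝ] E) y) =
      ∫ y in Metric.ball ((g : E →L[ℝ] E) z) ρ, u y := by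
  have h := (Unitary.linearIsometryEquiv g).measurePreserving.setIntegral_preimage_emb
    (Unitary.linearIsometryEquiv g).toHomeomorph.measurableEmbedding u
    (Metric.ball ((Unitary.linearIsometryEquiv g) z) ρ)
  have := (Unitary.linearIsometryEquiv g).preimage_ball ((Unitary.linearIsometryEquiv g) z) ρ
  rw [LinearIsometryEquiv.symm_apply_apply] at this
  rw [this] at h
  exact h

theorem setIntegral_ball_radialAverage {u : E → ℝ} (hu : Continuous u) (z : E) (ρ : ℝ) :
    ∫ y in Metric.ball z ρ, radialAverage u y =
      ∫ g, (∫ y in Metric.ball (((g⁻¹ : unitary (E →L[ℝ] E)) : E →L[ℝ] E) z) ρ, u y)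
        ∂haarUnitary := by
  unfold radialAverage
  rw [integral_integral_swap (integrable_uncurry_inv_unitary hu z ρ)]
  simp only [setIntegral_ball_comp_unitary]

theorem setIntegral_ball_zero_radialAverage {u : E → ℝ} (hu : Continuous u) (ρ : ℝ) :
    ∫ y in Metric.ball 0 ρ, radialAverage u y = ∫ y in Metric.ball 0 ρ, u y := by
  simp [setIntegral_ball_radialAverage hu]

theorem setIntegral_ball_radialAverage_le {u : E → ℝ} (hu : Continuous u) {z : E} {ρ : ℝ}
    (h : ∀ y, ‖y‖ = ‖z‖ → ∫ x in Metric.ball y ρ, u x ≤ volume.real (Metric.ball y ρ) * u y) :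
    ∫ y in Metric.ball z ρ, radialAverage u y ≤
      volume.real (Metric.ball z ρ) * radialAverage u z := by
  rw [setIntegral_ball_radialAverage hu, radialAverage, ← integral_const_mul]
  have hn : ∀ g : unitary (E →L[ℝ] E), ‖((g⁻¹ : unitary (E →L[ℝ] E)) : E →L[ℝ] E) z‖ = ‖z‖ :=
    fun g => ContinuousLinearMap.norm_map_of_mem_unitary (g⁻¹).2 z
  have hv : ∀ y : E, volume.real (Metric.ball y ρ) = volume.real (Metric.ball z ρ) := fun y => by
    rw [Measure.real, Measure.real, Measure.addHaar_ball_center, Measure.addHaar_ball_center _ z]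
  have hz : Continuous fun g : unitary (E →L[ℝ] E) => (z, g) := Continuous.prodMk_right z
  have hc := hu.comp (continuous_inv_unitary_apply.comp hz)
  refine integral_mono ?_ ?_ fun g => ?_
  · have := (integrable_uncurry_inv_unitary hu z ρ).integral_prod_right
    refine this.congr (Eventually.of_forall fun g => ?_)
    exact setIntegral_ball_comp_unitary u g⁻¹ z ρ
  · exact (hc.integrable_of_hasCompactSupport (HasCompactSupport.of_compactSpace _)).const_mul _
  · have := h _ (hn g)
    rwa [hv] at this

/-! ### From the local to the global super-mean value property -/

/-- A form of the minimum principle: a continuous radial function that is smaller at the origin than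
at `y` violates the super-mean value property on a small ball inside `B_‖y‖(0)`, namely around a
minimum point of largest norm. -/
theorem exists_setIntegral_ball_gt {v : E → ℝ} (hv : Continuous v)
    (hr : ∀ x y, ‖x‖ = ‖y‖ → v x = v y) {y : E} (hy : v 0 < v y) {ρ₀ : ℝ} (hρ : 0 < ρ₀) :
    ∃ z ρ, 0 < ρ ∧ ρ < ρ₀ ∧ ‖z‖ + ρ < ‖y‖ ∧
      volume.real (Metric.ball z ρ) * v z < ∫ x in Metric.ball z ρ, v x := by
  obtain ⟨z, hz, hmin⟩ := (isCompact_closedBall (0:E) ‖y‖).exists_isMinOn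
    ⟨0, by simp⟩ hv.continuousOn
  have hK : IsCompact (Metric.closedBall (0:E) ‖y‖ ∩ v ⁻¹' {v z}) :=
    (isCompact_closedBall _ _).inter_right (isClosed_singleton.preimage hv)
  obtain ⟨w, ⟨hw1, hw2⟩, hmax⟩ := hK.exists_isMaxOn ⟨z, hz, rfl⟩ continuous_norm.continuousOn
  have hw2 : v w = v z := hw2
  have hmin' : ∀ x, ‖x‖ ≤ ‖y‖ → v w ≤ v x := fun x hx => hw2 ▸ hmin (by simpa using hx)
  have hw3 : ‖w‖ < ‖y‖ := by
    refine lt_of_le_of_ne (by simpa using hw1) fun h => ?_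
    have := hr _ _ h
    have := hmin' 0 (by simp)
    linarith
  have hy0 : y ≠ 0 := by rintro rfl; exact lt_irrefl _ hy
  set ρ := min (ρ₀ / 2) ((‖y‖ - ‖w‖) / 2) with hρd
  have hρ1 : ρ ≤ ρ₀ / 2 := min_le_left _ _
  have hρ2 : ρ ≤ (‖y‖ - ‖w‖) / 2 := min_le_right _ _
  have hρ3 : 0 < ρ := lt_min (by linarith) (by linarith)
  have hball : ∀ x ∈ Metric.ball w ρ, ‖x‖ ≤ ‖y‖ := fun x hx => by
    have := norm_le_norm_add_norm_sub' x w
    rw [mem_ball_iff_norm] at hx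
    linarith
  refine ⟨w, ρ, hρ3, by linarith, by linarith, ?_⟩
  -- a point of the ball that is farther from the origin than `w`
  obtain ⟨a, ha1, ha2⟩ : ∃ a ∈ Metric.ball w ρ, ‖w‖ < ‖a‖ := by
    have hyn : 0 < ‖y‖ := norm_pos_iff.2 hy0
    by_cases h0 : w = 0
    · refine ⟨(ρ / 2 / ‖y‖) • y, ?_, ?_⟩
      · rw [h0, mem_ball_zero_iff, norm_smul, Real.norm_of_nonneg (by positivity),
          div_mul_cancel₀ _ hyn.ne']
        linarith
      · rw [h0, norm_zero, norm_smul, Real.norm_of_nonneg (by positivity)]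
        positivity
    · have hwn : 0 < ‖w‖ := norm_pos_iff.2 h0
      refine ⟨(1 + ρ / 2 / ‖w‖) • w, ?_, ?_⟩
      · rw [mem_ball_iff_norm, add_smul, one_smul, add_sub_cancel_left, norm_smul,
          Real.norm_of_nonneg (by positivity), div_mul_cancel₀ _ hwn.ne']
        linarith
      · rw [norm_smul, Real.norm_of_nonneg (by positivity)]
        have : 0 < ρ / 2 / ‖w‖ := by positivity
        nlinarith
  have ha3 : v w < v a := by
    refine lt_of_le_of_ne (hmin' a (hball a ha1)) fun h => ?_
    have := hmax (show a ∈ _ ∩ _ from ⟨by simpa using hball a ha1, h.symm.trans hw2⟩)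
    exact absurd ha2 (not_lt.2 this)
  have hint : IntegrableOn v (Metric.ball w ρ) :=
    (hv.continuousOn.integrableOn_compact (isCompact_closedBall w ρ)).mono_set
      Metric.ball_subset_closedBall
  have hfin : volume (Metric.ball w ρ) ≠ ∞ := measure_ball_lt_top.ne
  have hpos : 0 < ∫ x in Metric.ball w ρ, (v x - v w) := by
    rw [setIntegral_pos_iff_support_of_nonneg_ae]
    · have ho : IsOpen ({x | v w < v x} ∩ Metric.ball w ρ) :=
        (isOpen_lt continuous_const hv).inter Metric.isOpen_ball
      refine (ho.measure_pos volume ⟨a, ha3, ha1⟩).trans_le (measure_mono ?_)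
      exact Set.inter_subset_inter_left _ fun x (hx : v w < v x) => (sub_pos.2 hx).ne'
    · refine (ae_restrict_iff' measurableSet_ball).2 (Eventually.of_forall fun x hx => ?_)
      exact sub_nonneg.2 (hmin' x (hball x hx))
    · exact hint.sub (integrableOn_const hfin)
  rw [integral_sub hint (integrableOn_const hfin), setIntegral_const, smul_eq_mul] at hpos
  linarith

/-- A continuous function that dominates its mean over all balls of radius less than `ρ₀` inside
`B_r(x)` dominates its mean over `B_r(x)`: its radial average about `x` has the same two integrals
and is largest at the centre by the minimum principle. -/
theorem setIntegral_ball_le_of_local {u : E → ℝ} {x : E} {r ρ₀ : ℝ}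
    (hu : ContinuousOn u (Metric.closedBall x r)) (hρ : 0 < ρ₀)
    (h : ∀ y ρ, 0 < ρ → ρ < ρ₀ → Metric.closedBall y ρ ⊆ Metric.ball x r →
      ∫ z in Metric.ball y ρ, u z ≤ volume.real (Metric.ball y ρ) * u y) (hr : 0 < r) :
    ∫ z in Metric.ball x r, u z ≤ volume.real (Metric.ball x r) * u x := by
  -- extend `u` continuously and move the centre to the origin
  obtain ⟨f, hf⟩ := ContinuousMap.exists_restrict_eq (Metric.isClosed_closedBall (x := x) (ε := r))
    ⟨_, hu.domRestrict⟩
  have hfu : ∀ y ∈ Metric.closedBall x r, f y = u y := fun y hy => by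
    simpa using congrArg (fun k => k ⟨y, hy⟩) hf
  set v : E → ℝ := fun y => f (x + y) with hvd
  have hv : Continuous v := by fun_prop
  have hint : ∀ y ρ, Metric.ball (x + y) ρ ⊆ Metric.closedBall x r →
      ∫ z in Metric.ball y ρ, v z = ∫ z in Metric.ball (x + y) ρ, u z := fun y ρ hs => by
    rw [← setIntegral_congr_fun measurableSet_ball fun z hz => hfu z (hs hz),
      ← (measurePreserving_add_left volume x).setIntegral_preimage_emb
        (measurableEmbedding_addLeft x) f (Metric.ball (x + y) ρ)]
    simp [hvd]
  have hvol : ∀ (y y' : E) (ρ : ℝ), volume.real (Metric.ball y ρ) = volume.real (Metric.ball y' ρ) :=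
    fun y y' ρ => by
      rw [Measure.real, Measure.real, Measure.addHaar_ball_center, Measure.addHaar_ball_center _ y']
  have key : ∀ y ∈ Metric.ball (0:E) r, radialAverage v y ≤ radialAverage v 0 := by
    intro y hy
    by_contra! hlt
    rw [mem_ball_zero_iff] at hy
    obtain ⟨z, ρ, h1, h2, h3, h4⟩ := exists_setIntegral_ball_gt (continuous_radialAverage hv)
      (fun a b => radialAverage_eq_of_norm_eq v) hlt hρ
    refine absurd (setIntegral_ball_radialAverage_le hv (z := z) (ρ := ρ) fun a ha => ?_)
      (not_le.2 h4)
    have hsub : Metric.closedBall (x + a) ρ ⊆ Metric.ball x r :=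
      Metric.closedBall_subset_ball' (by simp; linarith)
    rw [hint a ρ (Metric.ball_subset_closedBall.trans (hsub.trans Metric.ball_subset_closedBall)),
      hvol a (x + a)]
    refine (h _ ρ h1 h2 hsub).trans_eq ?_
    rw [hvd, ← hfu _ (Metric.ball_subset_closedBall (hsub (Metric.mem_closedBall_self h1.le)))]
  have h0 := hint 0 r (by simpa using Metric.ball_subset_closedBall)
  rw [add_zero] at h0
  rw [← h0, ← setIntegral_ball_zero_radialAverage hv, hvol x 0,
    ← hfu x (Metric.mem_closedBall_self hr.le)]
  have hfin : volume (Metric.ball (0:E) r) ≠ ∞ := measure_ball_lt_top.ne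
  calc _ ≤ ∫ _ in Metric.ball (0:E) r, radialAverage v 0 := by
        refine setIntegral_mono_on ?_ (integrableOn_const hfin) measurableSet_ball key
        exact ((continuous_radialAverage hv).continuousOn.integrableOn_compact
          (isCompact_closedBall _ r)).mono_set Metric.ball_subset_closedBall
    _ = _ := by simp [radialAverage_zero, hvd]

end RadialAverage

/-! ### Continuous functions with the super-mean value property -/

section Supermean

variable {E : Type*} [NormedAddCommGroup E] [InnerProductSpace ℝ E] [FiniteDimensional ℝ E]
  [MeasurableSpace E] [BorelSpace E]

/-- `u` is continuous on `U` and dominates its mean over every ball whose closure lies in `U`; for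
open `U` these are the real-valued continuous superharmonic functions. The inequality is written
multiplied by the volume of the ball. -/
structure IsSupermean (u : E → ℝ) (U : Set E) : Prop where
  continuousOn : ContinuousOn u U
  setIntegral_le : ∀ x r, 0 < r → Metric.closedBall x r ⊆ U →
    ∫ y in Metric.ball x r, u y ≤ volume.real (Metric.ball x r) * u x

theorem integrableOn_ball_of_continuousOn {u : E → ℝ} {x : E} {r : ℝ}
    (hu : ContinuousOn u (Metric.closedBall x r)) : IntegrableOn u (Metric.ball x r) :=
  (hu.integrableOn_compact (isCompact_closedBall x r)).mono_set Metric.ball_subset_closedBall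

theorem IsSupermean.integrableOn {u : E → ℝ} {U : Set E} (hu : IsSupermean u U) {x : E} {r : ℝ}
    (h : Metric.closedBall x r ⊆ U) : IntegrableOn u (Metric.ball x r) :=
  integrableOn_ball_of_continuousOn (hu.continuousOn.mono h)

theorem isSupermean_const (c : ℝ) (U : Set E) : IsSupermean (fun _ => c) U :=
  ⟨continuousOn_const, fun x r _ _ => by simp⟩

theorem IsSupermean.const_mul {u : E → ℝ} {U : Set E} (hu : IsSupermean u U) {c : ℝ}
    (hc : 0 ≤ c) : IsSupermean (fun y => c * u y) U := by
  refine ⟨hu.continuousOn.const_mul _, fun x r hr h => ?_⟩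
  rw [integral_const_mul]
  nlinarith [mul_le_mul_of_nonneg_left (hu.setIntegral_le x r hr h) hc]

open Classical in
/-- Near each point of `U`, at the uniform scale `a`, the glued function is either the minimum of
two functions with the super-mean value property or coincides with `u`. -/
theorem IsSupermean.glue {u v : E → ℝ} {U V : Set E} (hu : IsSupermean u U)
    (hv : IsSupermean v V) (hU : IsOpen U) (hV : IsOpen V) {a : ℝ} (ha : 0 < a)
    (h : ∀ y ∈ U, U ∩ Metric.ball y a ⊆ V ∨ ∀ z ∈ U ∩ Metric.ball y a, z ∈ V → u z ≤ v z) :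
    IsSupermean (fun y => if y ∈ V then min (u y) (v y) else u y) U := by
  set w : E → ℝ := fun y => if y ∈ V then min (u y) (v y) else u y with hw
  have hwu : ∀ y, w y ≤ u y := fun y => by
    simp only [hw]; split_ifs
    exacts [min_le_left _ _, le_rfl]
  have hw1 : ∀ y ∈ V, w y = min (u y) (v y) := fun y hy => by simp [hw, hy]
  have hw2 : ∀ y, (y ∈ V → u y ≤ v y) → w y = u y := fun y hy => by
    simp only [hw]; split_ifs with h1
    exacts [min_eq_left (hy h1), rfl]
  have hcont : ContinuousOn w U := by
    intro y hy
    refine ContinuousAt.continuousWithinAt ?_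
    have hcu := hu.continuousOn.continuousAt (hU.mem_nhds hy)
    rcases h y hy with h1 | h1
    · have hyV : y ∈ V := h1 ⟨hy, Metric.mem_ball_self ha⟩
      have hmin : ContinuousAt (fun z => min (u z) (v z)) y :=
        hcu.min (hv.continuousOn.continuousAt (hV.mem_nhds hyV))
      refine hmin.congr ?_
      filter_upwards [hV.mem_nhds hyV] with z hz using (hw1 z hz).symm
    · refine hcu.congr ?_
      filter_upwards [hU.mem_nhds hy, Metric.ball_mem_nhds y ha] with z hz1 hz2
      exact (hw2 z (h1 z ⟨hz1, hz2⟩)).symm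
  refine ⟨hcont, fun x r hr hx => ?_⟩
  refine setIntegral_ball_le_of_local (hcont.mono hx) ha (fun z ρ hρ hρa hz => ?_) hr
  have hzU : Metric.closedBall z ρ ⊆ U := hz.trans (Metric.ball_subset_closedBall.trans hx)
  have hza : Metric.closedBall z ρ ⊆ Metric.ball z a := Metric.closedBall_subset_ball hρa
  have hzz : z ∈ Metric.closedBall z ρ := Metric.mem_closedBall_self hρ.le
  have hwi := integrableOn_ball_of_continuousOn (hcont.mono hzU)
  have hle_u : ∫ y in Metric.ball z ρ, w y ≤ volume.real (Metric.ball z ρ) * u z :=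
    (integral_mono hwi (hu.integrableOn hzU) hwu).trans (hu.setIntegral_le z ρ hρ hzU)
  rcases h z (hzU hzz) with h1 | h1
  · have hzV : Metric.closedBall z ρ ⊆ V := fun y hy => h1 ⟨hzU hy, hza hy⟩
    have hle_v : ∫ y in Metric.ball z ρ, w y ≤ volume.real (Metric.ball z ρ) * v z := by
      refine le_trans ?_ (hv.setIntegral_le z ρ hρ hzV)
      refine setIntegral_mono_on hwi (hv.integrableOn hzV) measurableSet_ball fun y hy => ?_
      rw [hw1 y (hzV (Metric.ball_subset_closedBall hy))]
      exact min_le_right _ _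
    rw [hw1 z (hzV hzz), mul_min_of_nonneg _ _ measureReal_nonneg]
    exact le_min hle_u hle_v
  · rwa [hw2 z (h1 z ⟨hzU hzz, hza hzz⟩)]

end Supermean

/-! ### A quadratic harmonic barrier in a truncated half-space -/

section Quadratic

variable {E : Type*} [NormedAddCommGroup E] [InnerProductSpace ℝ E]

/-- The harmonic polynomial `‖v‖² + n s (2 - s)`, where `n` is the dimension, `v = (y - p) / R` and
`s = δ - ⟪v, e⟫`; its Laplacian is `(2 n - 2 n ‖e‖²) / R² = 0` for a unit vector `e`. Where
`0 ≤ s ≤ 2`, it is at least `‖v‖²`, and at most `‖v‖² + 2 n (δ + ‖v‖)`. -/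
noncomputable def halfSpaceBarrier (p e : E) (R δ : ℝ) (y : E) : ℝ :=
  (‖y - p‖ / R) ^ 2 + Module.finrank ℝ E *
    ((δ - inner ℝ (y - p) e / R) * (2 - (δ - inner ℝ (y - p) e / R)))

theorem continuous_halfSpaceBarrier (p e : E) (R δ : ℝ) :
    Continuous (halfSpaceBarrier p e R δ) := by
  unfold halfSpaceBarrier; fun_prop

variable [FiniteDimensional ℝ E] [MeasurableSpace E] [BorelSpace E]

theorem setIntegral_ball_inner (a : E) (r : ℝ) :
    ∫ h in Metric.ball (0 : E) r, inner ℝ a h = 0 := by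
  have := setIntegral_ball_comp_unitary (fun h : E => (inner ℝ a h : ℝ)) (-1) 0 r
  rw [show ((-1 : unitary (E →L[ℝ] E)) : E →L[ℝ] E) = -1 from rfl, map_zero] at this
  simp only [neg_apply, one_apply_eq_self, inner_neg_right, integral_neg] at this
  linarith

/-- By rotation invariance the second moment is the same in all directions, so that each one
contributes `1 / finrank` of the integral of `‖h‖ ^ 2`. -/
theorem setIntegral_ball_inner_sq {e : E} (he : ‖e‖ = 1) (r : ℝ) :
    Module.finrank ℝ E * ∫ h in Metric.ball (0 : E) r, (inner ℝ e h : ℝ) ^ 2 =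
      ∫ h in Metric.ball (0 : E) r, ‖h‖ ^ 2 := by
  have hrot : ∀ e' : E, ‖e'‖ = 1 → ∫ h in Metric.ball (0 : E) r, (inner ℝ e' h : ℝ) ^ 2 =
      ∫ h in Metric.ball (0 : E) r, (inner ℝ e h : ℝ) ^ 2 := fun e' he' => by
    obtain ⟨g, hg⟩ := exists_unitary_apply_eq (he.trans he'.symm)
    have := setIntegral_ball_comp_unitary (fun h : E => (inner ℝ e' h : ℝ) ^ 2) g 0 r
    rw [map_zero] at this
    rw [← this, ← hg]
    simp only [ContinuousLinearMap.inner_map_map_of_mem_unitary g.2]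
  let b := stdOrthonormalBasis ℝ E
  have hsum : ∀ h : E, ‖h‖ ^ 2 = ∑ i, (inner ℝ (b i) h : ℝ) ^ 2 := fun h =>
    (b.sum_sq_inner_right h).symm
  simp_rw [hsum]
  rw [integral_finsetSum _ fun i _ => integrableOn_ball_of_continuousOn (by fun_prop)]
  simp [hrot _ (b.norm_eq_one _)]

/-- The mean value property of a quadratic polynomial whose Hessian has trace zero, for a Hessian of
the form `2 c (1 - n e ⊗ e)` in dimension `n`. -/
theorem setIntegral_ball_of_quadratic {q : E → ℝ} {y a e : E} {c : ℝ} (he : ‖e‖ = 1)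
    (hq : ∀ h, q (y + h) = q y + inner ℝ a h +
      c * (‖h‖ ^ 2 - Module.finrank ℝ E * (inner ℝ e h) ^ 2)) (r : ℝ) :
    ∫ z in Metric.ball y r, q z = volume.real (Metric.ball y r) * q y := by
  have h1 := (measurePreserving_add_left volume y).setIntegral_preimage_emb
        (measurableEmbedding_addLeft y) q (Metric.ball y r)
  have hv : volume.real (Metric.ball (0:E) r) = volume.real (Metric.ball y r) := by
    rw [Measure.real, Measure.real, Measure.addHaar_ball_center _ y]
  have hi : ∀ f : E → ℝ, Continuous f → IntegrableOn f (Metric.ball 0 r) := fun f hf =>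
    integrableOn_ball_of_continuousOn hf.continuousOn
  rw [← h1]
  simp_rw [hq, preimage_add_ball, sub_self]
  rw [integral_add (hi (fun h => q y + inner ℝ a h) (by fun_prop))
      (hi (fun h => c * (‖h‖ ^ 2 - Module.finrank ℝ E * (inner ℝ e h) ^ 2)) (by fun_prop)),
    integral_add (hi (fun _ => q y) (by fun_prop)) (hi (fun h => inner ℝ a h) (by fun_prop)),
    setIntegral_ball_inner, integral_const_mul,
    integral_sub (hi (fun h => ‖h‖ ^ 2) (by fun_prop))
      (hi (fun h => Module.finrank ℝ E * (inner ℝ e h) ^ 2) (by fun_prop)), integral_const_mul,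
    setIntegral_ball_inner_sq he, setIntegral_const, hv, smul_eq_mul]
  ring

theorem setIntegral_ball_halfSpaceBarrier (p : E) {e : E} (he : ‖e‖ = 1) (R δ : ℝ) (y : E) (r : ℝ) :
    ∫ z in Metric.ball y r, halfSpaceBarrier p e R δ z =
      volume.real (Metric.ball y r) * halfSpaceBarrier p e R δ y := by
  refine setIntegral_ball_of_quadratic (c := (R⁻¹) ^ 2)
    (a := (2 * (R⁻¹) ^ 2) • (y - p) + (Module.finrank ℝ E * (2 * δ * R⁻¹ - 2 * R⁻¹ -
      2 * (R⁻¹) ^ 2 * inner ℝ (y - p) e)) • e) he (fun h => ?_) r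
  have h1 : y + h - p = (y - p) + h := by abel
  simp only [halfSpaceBarrier, h1, div_eq_mul_inv, mul_pow, inner_add_left, norm_add_sq_real,
    inner_smul_left, real_inner_comm h e, conj_trivial]
  ring

/-- The barrier is defined on each connected component of `Ω ∩ B_R(p)` with the direction of that
component; a closed ball in `Ω ∩ B_R(p)` meets only one component. -/
theorem exists_barrier {Ω : Set E} (hΩ : IsOpen Ω) {p : E} {R δ : ℝ} (hR : 0 < R)
    (hδ : δ ∈ Set.Icc (0 : ℝ) 1)
    (h : ∀ y ∈ Ω ∩ Metric.ball p R, ∃ e : E, ‖e‖ = 1 ∧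
      connectedComponentIn (Ω ∩ Metric.ball p R) y ⊆
        {x | x ∈ Metric.ball p R ∧ inner ℝ (x - p) e < δ * R}) :
    ∃ φ : E → ℝ, IsSupermean φ (Ω ∩ Metric.ball p R) ∧ ∀ y ∈ Ω ∩ Metric.ball p R,
      (dist y p / R) ^ 2 ≤ φ y ∧
      φ y ≤ (dist y p / R) ^ 2 + 2 * Module.finrank ℝ E * (δ + dist y p / R) := by
  classical
  set U := Ω ∩ Metric.ball p R with hUd
  have hU : IsOpen U := hΩ.inter Metric.isOpen_ball
  -- the direction is a function of the component as a set, hence constant on components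
  obtain ⟨e, he⟩ : ∃ e : Set E → E, ∀ y ∈ U, ‖e (connectedComponentIn U y)‖ = 1 ∧
      connectedComponentIn U y ⊆ {x | x ∈ Metric.ball p R ∧
        inner ℝ (x - p) (e (connectedComponentIn U y)) < δ * R} := by
    refine ⟨fun S => if hS : ∃ e : E, ‖e‖ = 1 ∧ S ⊆ {x | x ∈ Metric.ball p R ∧
      inner ℝ (x - p) e < δ * R} then hS.choose else 0, fun y hy => ?_⟩
    simp only [dif_pos (h y hy)]
    exact (h y hy).choose_spec
  have heq : ∀ x ∈ U, ∀ y ∈ connectedComponentIn U x,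
      halfSpaceBarrier p (e (connectedComponentIn U y)) R δ y =
        halfSpaceBarrier p (e (connectedComponentIn U x)) R δ y := fun x hx y hy => by
    rw [connectedComponentIn_eq hy]
  refine ⟨fun y => halfSpaceBarrier p (e (connectedComponentIn U y)) R δ y,
    ⟨fun x hx => ?_, fun x r hr hx => ?_⟩, fun y hy => ?_⟩
  · refine ContinuousAt.continuousWithinAt ?_
    refine (continuous_halfSpaceBarrier p (e (connectedComponentIn U x)) R δ).continuousAt.congr ?_
    filter_upwards [hU.connectedComponentIn.mem_nhds (mem_connectedComponentIn hx)] with y hy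
    exact (heq x hx y hy).symm
  · have hxx : x ∈ Metric.closedBall x r := Metric.mem_closedBall_self hr.le
    have hsub : Metric.closedBall x r ⊆ connectedComponentIn U x :=
      (convex_closedBall x r).isPreconnected.subset_connectedComponentIn hxx hx
    rw [setIntegral_congr_fun measurableSet_ball fun y hy =>
      heq x (hx hxx) y (hsub (Metric.ball_subset_closedBall hy)),
      setIntegral_ball_halfSpaceBarrier p (he x (hx hxx)).1]
  · obtain ⟨h1, h2⟩ := he y hy
    set f := e (connectedComponentIn U y)
    have h3 : inner ℝ (y - p) f < δ * R := (h2 (mem_connectedComponentIn hy)).2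
    have h4 : |inner ℝ (y - p) f| ≤ dist y p := by
      have := abs_real_inner_le_norm (y - p) f
      rwa [h1, mul_one, ← dist_eq_norm] at this
    have h5 : dist y p / R < 1 := (div_lt_one hR).2 hy.2
    have h6 : inner ℝ (y - p) f / R < δ := (div_lt_iff₀ hR).2 h3
    have h7 : -(dist y p / R) ≤ inner ℝ (y - p) f / R := by
      rw [← neg_div]; gcongr; exact (abs_le.1 h4).1
    have hn : (0 : ℝ) ≤ Module.finrank ℝ E := by positivity
    simp only [halfSpaceBarrier, ← dist_eq_norm]
    set t := inner ℝ (y - p) f / R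
    set s := dist y p / R
    have h8 : 0 ≤ (δ - t) * (2 - (δ - t)) := mul_nonneg (by linarith) (by linarith [hδ.2])
    have h9 : (δ - t) * (2 - (δ - t)) ≤ 2 * (δ + s) := by nlinarith
    constructor
    · nlinarith [mul_nonneg hn h8]
    · nlinarith [mul_le_mul_of_nonneg_left h9 hn]

end Quadratic

/-! ### Upper bounds for the harmonic measure -/

section Superharmonic

variable {d : ℕ}

theorem IsSupermean.isClassicalSuperharmonicOn {φ : EuclideanSpace ℝ (Fin d) → ℝ}
    {U : Set (EuclideanSpace ℝ (Fin d))} (hφ : IsSupermean φ U) (h0 : ∀ y ∈ U, 0 ≤ φ y) :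
    IsClassicalSuperharmonicOn (fun y => (φ y : EReal)) U where
  ne_bot _ _ := EReal.coe_ne_bot _
  lsc := (continuous_coe_real_ereal.comp_continuousOn hφ.continuousOn).lowerSemicontinuousOn
  mean_le x _ r hr hx := by
    have hb : ∀ y ∈ Metric.ball x r, 0 ≤ φ y := fun y hy =>
      h0 y (hx (Metric.ball_subset_closedBall hy))
    have hneg : (⨍⁻ y in Metric.ball x r, (-(φ y : EReal)).toENNReal ∂volume) = 0 := by
      rw [setLAverage_eq, setLIntegral_congr_fun measurableSet_ball (g := fun _ => 0) fun y hy => ?_]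
      · simp
      · exact EReal.toENNReal_of_nonpos (by simpa using hb y hy)
    have hpos : (⨍⁻ y in Metric.ball x r, (φ y : EReal).toENNReal ∂volume) =
        ENNReal.ofReal (⨍ y in Metric.ball x r, φ y) := by
      rw [ofReal_setAverage (hφ.integrableOn hx)
        ((ae_restrict_iff' measurableSet_ball).2 (Eventually.of_forall hb)), setLAverage_eq]
      simp
    rw [hneg, hpos]
    have hv : 0 < volume.real (Metric.ball x r) :=
      ENNReal.toReal_pos (Metric.measure_ball_pos volume x hr).ne' measure_ball_lt_top.ne
    have hle : ⨍ y in Metric.ball x r, φ y ≤ φ x := by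
      rw [setAverage_eq, smul_eq_mul, inv_mul_le_iff₀ hv]
      exact hφ.setIntegral_le x r hr hx
    have hx0 : 0 ≤ φ x := h0 x (hx (Metric.mem_closedBall_self hr.le))
    rw [EReal.coe_ennreal_ofReal]
    simpa using ⟨hle, hx0⟩
  ne_top x hx := ⟨x, mem_connectedComponentIn hx, EReal.coe_ne_top _⟩

end Superharmonic

/-- The lower bound of `φ` by `(dist y p / r) ^ 2` near the sphere is what gives boundary values at
least `1` on `Ω ∩ ∂B_r(p)`. -/
theorem localHarmonicMeasure_le {d : ℕ} {Ω : Set (EuclideanSpace ℝ (Fin d))}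
    {p x : EuclideanSpace ℝ (Fin d)} {r : ℝ} (hr : 0 < r) {φ : EuclideanSpace ℝ (Fin d) → ℝ}
    (hφ : IsSupermean φ (Ω ∩ Metric.ball p r)) (h : ∀ y ∈ Ω ∩ Metric.ball p r, 0 ≤ φ y ∧
      (3 / 4 * r ≤ dist y p → (dist y p / r) ^ 2 ≤ φ y)) :
    localHarmonicMeasure Ω x p r ≤ (φ x : EReal) := by
  refine sInf_le ⟨fun y => (φ y : EReal), hφ.isClassicalSuperharmonicOn fun y hy => (h y hy).1,
    fun z hz => ?_, rfl⟩
  set U := Ω ∩ Metric.ball p r with hU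
  by_cases hzs : z ∈ Ω ∩ Metric.sphere p r
  · rw [Set.indicator_of_mem hzs]
    have hne : (𝓝[U] z).NeBot := mem_closure_iff_nhdsWithin_neBot.1 (frontier_subset_closure hz)
    have hzr : dist z p = r := hzs.2
    have ht : Tendsto (fun y => ((dist y p / r) ^ 2 : ℝ)) (𝓝[U] z) (𝓝 1) := by
      have hc : Continuous fun y : EuclideanSpace ℝ (Fin d) => (dist y p / r) ^ 2 := by fun_prop
      have := (hc.tendsto z).mono_left (nhdsWithin_le_nhds (s := U))
      simpa [hzr, div_self hr.ne'] using this
    have ht' := (continuous_coe_real_ereal.tendsto 1).comp ht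
    rw [← ht'.liminf_eq]
    refine liminf_le_liminf ?_
    have hfar : ∀ᶠ y in 𝓝[U] z, 3 / 4 * r < dist y p := by
      refine nhdsWithin_le_nhds ((isOpen_lt continuous_const (by fun_prop)).mem_nhds ?_)
      simp only [Set.mem_ofPred_eq, hzr]
      linarith
    filter_upwards [hfar, self_mem_nhdsWithin] with y hy hyU
    exact EReal.coe_le_coe_iff.2 ((h y hyU).2 hy.le)
  · rw [Set.indicator_of_notMem hzs]
    refine le_liminf_of_le (by isBoundedDefault) ?_
    filter_upwards [self_mem_nhdsWithin] with y hyU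
    exact EReal.coe_le_coe_iff.2 (h y hyU).1

/-! ### Iteration over geometric scales -/

/-- One step of the iteration glues `c R * φ₁`, where `φ₁` is the function already built at radius
`η R`, to the barrier `φ₀` at radius `R`. The bound `φ₀ ≤ c R / 2` on the ball of radius `η R` and
the bound `φ₁ ≥ (3 / 4) ^ 2 > 1 / 2` near its boundary sphere make the glued function equal to `φ₀`
around that sphere, with a margin proportional to `η R`. -/
theorem exists_iterated_barrier {E : Type*} [NormedAddCommGroup E] [InnerProductSpace ℝ E]
    [FiniteDimensional ℝ E] [MeasurableSpace E] [BorelSpace E] {Ω : Set E} (hΩ : IsOpen Ω) {p : E}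
    {η : ℝ} (hη0 : 0 < η) (hη : η ≤ 1 / 2) {c : ℝ → ℝ} (hc : ∀ R, 0 < R → 0 < c R)
    (h : ∀ R, 0 < R → ∃ φ : E → ℝ, IsSupermean φ (Ω ∩ Metric.ball p R) ∧
      ∀ y ∈ Ω ∩ Metric.ball p R, (dist y p / R) ^ 2 ≤ φ y ∧ (dist y p < η * R → φ y ≤ c R / 2))
    (k : ℕ) {R : ℝ} (hR : 0 < R) :
    ∃ φ : E → ℝ, IsSupermean φ (Ω ∩ Metric.ball p R) ∧
      ∀ y ∈ Ω ∩ Metric.ball p R, 0 ≤ φ y ∧ (3 / 4 * R ≤ dist y p → (dist y p / R) ^ 2 ≤ φ y) ∧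
        (dist y p < η ^ k * R → φ y ≤ ∏ j ∈ Finset.range k, c (η ^ j * R)) := by
  classical
  induction k generalizing R with
  | zero =>
    refine ⟨fun _ => 1, isSupermean_const _ _, fun y hy => ⟨zero_le_one, fun _ => ?_, fun _ => ?_⟩⟩
    · exact pow_le_one₀ (by positivity) ((div_le_one hR).2 (le_of_lt hy.2))
    · simp
  | succ k ih =>
    have hηR : 0 < η * R := mul_pos hη0 hR
    have hηR' : η * R ≤ 1 / 2 * R := by gcongr
    obtain ⟨φ₀, hs₀, h₀⟩ := h R hR
    obtain ⟨φ₁, hs₁, h₁⟩ := ih hηR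
    have hcR := hc R hR
    refine ⟨_, hs₀.glue (hs₁.const_mul hcR.le) (hΩ.inter Metric.isOpen_ball)
      (hΩ.inter Metric.isOpen_ball) (a := η * R / 8) (by positivity) fun y hy => ?_, fun y hy => ?_⟩
    · rcases lt_or_ge (dist y p) (7 / 8 * (η * R)) with hyp | hyp
      · refine Or.inl fun z hz => ⟨hz.1.1, ?_⟩
        have h1 := dist_triangle z y p
        have h2 : dist z y < η * R / 8 := hz.2
        rw [Metric.mem_ball]
        linarith
      · refine Or.inr fun z hz hzV => ?_
        have h1 := dist_triangle y z p
        have h2 : dist z y < η * R / 8 := hz.2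
        rw [dist_comm] at h2
        have h3 : 3 / 4 ≤ dist z p / (η * R) := (le_div_iff₀ hηR).2 (by linarith)
        have h4 := (h₁ z hzV).2.1 (by linarith)
        have h5 := (h₀ z hz.1).2 hzV.2
        have h6 : 1 / 2 ≤ φ₁ z := by nlinarith
        nlinarith
    · have hy0 : 0 ≤ φ₀ y := (sq_nonneg _).trans (h₀ y hy).1
      refine ⟨?_, fun hyR => ?_, fun hyk => ?_⟩
      · split_ifs with hyV
        · exact le_min hy0 (mul_nonneg hcR.le (h₁ y hyV).1)
        · exact hy0
      · have hyV : y ∉ Ω ∩ Metric.ball p (η * R) := fun hyV => by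
          have : dist y p < η * R := hyV.2
          linarith
        rw [if_neg hyV]
        exact (h₀ y hy).1
      · have hk : η ^ (k + 1) * R = η ^ k * (η * R) := by ring
        rw [hk] at hyk
        have hyV : y ∈ Ω ∩ Metric.ball p (η * R) := by
          refine ⟨hy.1, hyk.trans_le ?_⟩
          exact mul_le_of_le_one_left hηR.le (pow_le_one₀ hη0.le (by linarith))
        rw [if_pos hyV, Finset.prod_range_succ']
        refine (min_le_right _ _).trans ?_
        rw [pow_zero, one_mul, mul_comm]
        simp_rw [pow_succ, mul_assoc]
        exact mul_le_mul_of_nonneg_right ((h₁ y hyV).2.2 hyk) hcR.le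

/-! ### Counting the uncontrolled scales -/

open Classical in
/-- Only boundedly many terms of a geometric sequence of ratio `η` lie strictly between
`R₀ = κ R₁` and `R₁`. -/
theorem card_intermediate_scales_le {η κ R R₀ R₁ : ℝ} (hη0 : 0 < η) (hη : η ≤ 1) (hR : 0 < R)
    (hκ0 : 0 < κ) (hκ : R₀ = κ * R₁) {N : ℕ} (hN : η ^ N ≤ κ) (k : ℕ) :
    ((Finset.range k).filter fun j => ¬(η ^ j * R ≤ R₀ ∨ R₁ ≤ η ^ j * R)).card ≤ N := by
  set B := (Finset.range k).filter fun j => ¬(η ^ j * R ≤ R₀ ∨ R₁ ≤ η ^ j * R)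
  rcases B.eq_empty_or_nonempty with hB | hB
  · simp [hB]
  have hj0 := B.min'_mem hB
  set j₀ := B.min' hB
  refine (Finset.card_le_card (t := Finset.Ico j₀ (j₀ + N)) fun j hj => ?_).trans (by simp)
  refine Finset.mem_Ico.2 ⟨B.min'_le j hj, ?_⟩
  by_contra! hle
  obtain ⟨-, h1⟩ := Finset.mem_filter.1 hj
  obtain ⟨-, h2⟩ := Finset.mem_filter.1 hj0
  push Not at h1 h2
  have h3 : η ^ j ≤ η ^ N * η ^ j₀ := by
    rw [← pow_add, add_comm]; exact pow_le_pow_of_le_one hη0.le hη hle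
  have h4 : η ^ N * (η ^ j₀ * R) ≤ κ * R₁ := by gcongr; exact h2.2.le
  have h5 : η ^ j * R ≤ η ^ N * (η ^ j₀ * R) := by
    rw [← mul_assoc]; gcongr
  linarith [h1.1]

open Classical in
theorem prod_scale_factors_le {η κ R R₀ R₁ h : ℝ} (hη0 : 0 < η) (hη : η ≤ 1) (hR : 0 < R)
    (hκ0 : 0 < κ) (hκ : R₀ = κ * R₁) {N : ℕ} (hN : η ^ N ≤ κ) (h0 : 0 < h) (h1 : h ≤ 1) (k : ℕ) :
    ∏ j ∈ Finset.range k, (if η ^ j * R ≤ R₀ ∨ R₁ ≤ η ^ j * R then h else 2) ≤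
      (2 / h) ^ N * h ^ k := by
  have heq : ∀ j, (if η ^ j * R ≤ R₀ ∨ R₁ ≤ η ^ j * R then h else 2) =
      (if ¬(η ^ j * R ≤ R₀ ∨ R₁ ≤ η ^ j * R) then 2 / h else 1) * h := fun j => by
    by_cases hj : η ^ j * R ≤ R₀ ∨ R₁ ≤ η ^ j * R
    · simp [hj]
    · simp [hj, h0.ne']
  simp_rw [heq, Finset.prod_mul_distrib, Finset.prod_const, Finset.card_range]
  rw [← Finset.prod_filter, Finset.prod_const]
  gcongr
  · rw [le_div_iff₀ h0]; linarith
  · exact card_intermediate_scales_le hη0 hη hR hκ0 hκ hN k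

/-! ### Decay of the local harmonic measure -/

/-- The infimum defining `extFlatness` is over a non-empty set, since `1` always belongs to it (a
unit vector exists because `0 < d`), so it is not a junk value. -/
theorem exists_mem_ER_of_extFlatness_lt {d : ℕ} (hd : 0 < d)
    {Ω : Set (EuclideanSpace ℝ (Fin d))} {R η : ℝ} (hR : 0 < R) (h : extFlatness Ω R < η) :
    ∃ δ < η, (δ, R) ∈ ER Ω := by
  have hne : {δ : ℝ | (δ, R) ∈ ER Ω}.Nonempty := by
    refine ⟨1, ⟨by simp, hR, fun p _ y _ => ⟨EuclideanSpace.single ⟨0, hd⟩ 1, by simp, ?_⟩⟩⟩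
    intro x hx
    have hx := (connectedComponentIn_subset _ _ hx).2
    refine ⟨hx, ?_⟩
    have h1 := real_inner_le_norm (x - p) (EuclideanSpace.single (⟨0, hd⟩ : Fin d) (1 : ℝ))
    have h2 : ‖EuclideanSpace.single (⟨0, hd⟩ : Fin d) (1 : ℝ)‖ = 1 := by simp
    rw [h2, ← dist_eq_norm] at h1
    have h3 : dist x p < R := hx
    simp only
    linarith
  obtain ⟨δ, h1, h2⟩ := exists_lt_of_csInf_lt hne h
  exact ⟨δ, h2, h1⟩

theorem exists_barrier_of_extFlatness_lt {d : ℕ} (hd : 0 < d)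
    {Ω : Set (EuclideanSpace ℝ (Fin d))} (hΩ : IsOpen Ω) {p : EuclideanSpace ℝ (Fin d)}
    (hp : p ∈ frontier Ω) {R η : ℝ} (hR : 0 < R) (hη : η ≤ 1) (h : extFlatness Ω R < η) :
    ∃ φ : EuclideanSpace ℝ (Fin d) → ℝ, IsSupermean φ (Ω ∩ Metric.ball p R) ∧
      ∀ y ∈ Ω ∩ Metric.ball p R, (dist y p / R) ^ 2 ≤ φ y ∧
        (dist y p < η * R → φ y ≤ (4 * d + 1) * η) := by
  obtain ⟨δ, hδη, hδ, -, hER⟩ := exists_mem_ER_of_extFlatness_lt hd hR h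
  obtain ⟨φ, hs, hφ⟩ := exists_barrier hΩ hR hδ (hER p hp)
  refine ⟨φ, hs, fun y hy => ⟨(hφ y hy).1, fun hyη => (hφ y hy).2.trans ?_⟩⟩
  rw [finrank_euclideanSpace_fin]
  have h1 : dist y p / R < η := (div_lt_iff₀ hR).2 hyη
  have h2 : 0 ≤ dist y p / R := by positivity
  have h3 : (dist y p / R) ^ 2 ≤ η := by nlinarith
  have h4 : 2 * (d : ℝ) * (δ + dist y p / R) ≤ 2 * d * (η + η) := by gcongr
  linarith

theorem LHMDWith_of_TERWith {d : ℕ} (hd : 0 < d) {ε η : ℝ} (hε : ε < 1) (hη0 : 0 < η)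
    (hη : η ≤ 1 / 2) (hηε : 2 * ((4 * d + 1) * η) ≤ η ^ (1 - ε)) {κ : ℝ} (hκ : 0 < κ) {N : ℕ}
    (hN : η ^ N ≤ κ) {Ω : Set (EuclideanSpace ℝ (Fin d))} (hΩ : IsOpen Ω) {R₀ Rinf : ℝ}
    (hR : R₀ / Rinf = κ) (hT : TERWith Ω (η / 2) R₀ Rinf) :
    LHMDWith Ω (1 - ε) ((2 / η ^ (1 - ε)) ^ N / η ^ (1 - ε)) := by
  classical
  intro p hp r hr x hx
  obtain ⟨hR0, hRR, hflat⟩ := hT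
  have hxp : 0 < dist x p := dist_pos.2 fun hxp => by
    rw [hΩ.frontier_eq] at hp
    exact hp.2 (hxp ▸ hx.1)
  set α := 1 - ε
  have hα : 0 < α := by simp only [α]; linarith
  set c : ℝ → ℝ := fun R => if R ≤ R₀ ∨ Rinf ≤ R then η ^ α else 2 with hcd
  have hηα : 0 < η ^ α := Real.rpow_pos_of_pos hη0 _
  have hηα1 : η ^ α ≤ 1 := Real.rpow_le_one hη0.le (by linarith) hα.le
  have hbar : ∀ R, 0 < R → ∃ φ : EuclideanSpace ℝ (Fin d) → ℝ,
      IsSupermean φ (Ω ∩ Metric.ball p R) ∧ ∀ y ∈ Ω ∩ Metric.ball p R,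
        (dist y p / R) ^ 2 ≤ φ y ∧ (dist y p < η * R → φ y ≤ c R / 2) := fun R hR' => by
    by_cases hgood : R ≤ R₀ ∨ Rinf ≤ R
    · obtain ⟨φ, hs, hφ⟩ := exists_barrier_of_extFlatness_lt hd hΩ hp hR' (by linarith : η ≤ 1)
        ((hflat R hR' hgood).trans_lt (by linarith))
      refine ⟨φ, hs, fun y hy => ⟨(hφ y hy).1, fun hyη => ((hφ y hy).2 hyη).trans ?_⟩⟩
      simp only [hcd, if_pos hgood]
      linarith
    · -- at an uncontrolled scale the constant `1` serves, at the cost of the factor `2`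
      refine ⟨fun _ => 1, isSupermean_const _ _, fun y hy => ⟨?_, fun _ => ?_⟩⟩
      · exact pow_le_one₀ (by positivity) ((div_le_one hR').2 (le_of_lt hy.2))
      · simp [hcd, if_neg hgood]
  have hRinf : 0 < Rinf := hR0.trans_le hRR
  -- the strict upper bound places `x` in the open ball of radius `η ^ k * r`
  obtain ⟨k, hk1, hk2⟩ : ∃ k : ℕ, η ^ (k + 1) ≤ dist x p / r ∧ dist x p / r < η ^ k := by
    have hex : ∃ k : ℕ, η ^ k ≤ dist x p / r :=
      (exists_pow_lt_of_lt_one (div_pos hxp hr) (by linarith : η < 1)).imp fun _ h => h.le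
    have hpos : Nat.find hex ≠ 0 := fun h0 => by
      have h1 := Nat.find_spec hex
      rw [h0, pow_zero, one_le_div hr] at h1
      exact absurd (Metric.mem_ball.1 hx.2) (not_lt.2 h1)
    obtain ⟨k, hk⟩ := Nat.exists_eq_succ_of_ne_zero hpos
    exact ⟨k, by simpa [hk] using Nat.find_spec hex, not_le.1 (Nat.find_min hex (by omega))⟩
  obtain ⟨φ, hs, hφ⟩ := exists_iterated_barrier hΩ hη0 hη
    (fun R _ => by simp only [hcd]; split_ifs <;> positivity) hbar k hr
  refine (localHarmonicMeasure_le hr hs fun y hy => ⟨(hφ y hy).1, (hφ y hy).2.1⟩).trans ?_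
  refine EReal.coe_le_coe_iff.2 (((hφ x hx).2.2 ((div_lt_iff₀ hr).1 hk2)).trans ?_)
  refine (prod_scale_factors_le hη0 (by linarith) hr hκ ((div_eq_iff hRinf.ne').1 hR) hN hηα hηα1
    k).trans ?_
  have hstep : (η ^ α) ^ (k + 1) ≤ (dist x p / r) ^ α := by
    rw [← Real.rpow_natCast, ← Real.rpow_mul hη0.le, mul_comm, Real.rpow_mul hη0.le,
      Real.rpow_natCast]
    exact Real.rpow_le_rpow (by positivity) hk1 hα.le
  calc (2 / η ^ α) ^ N * (η ^ α) ^ k = (2 / η ^ α) ^ N / η ^ α * (η ^ α) ^ (k + 1) := by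
        rw [pow_succ]; field_simp
    _ ≤ _ := by gcongr

end HarmonicDecay

theorem theorem231217511 (d : ℕ) (hd : 2 ≤ d) (ε : ℝ) (hε : ε ∈ Set.Ioo (0 : ℝ) 1) :
    ∃ δ : ℝ, 0 < δ ∧ δ ≤ 1 ∧
      (∀ Ω : Set (EuclideanSpace ℝ (Fin d)), IsOpen Ω → IsConnected Ω →
        HarmonicDecay.TER Ω δ → HarmonicDecay.LHMD Ω (1 - ε)) ∧
      (∀ κ ∈ Set.Ioc (0 : ℝ) 1, ∃ M : ℝ, 0 < M ∧
        ∀ Ω : Set (EuclideanSpace ℝ (Fin d)), IsOpen Ω → IsConnected Ω →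
          ∀ R₀ Rinf : ℝ, R₀ / Rinf = κ → HarmonicDecay.TERWith Ω δ R₀ Rinf →
            HarmonicDecay.LHMDWith Ω (1 - ε) M) := by
  obtain ⟨hε0, hε1⟩ := hε
  -- `η = q ^ (1 / ε)` turns the linear bound `(4 d + 1) η` of the barrier into `η ^ (1 - ε) / 2`
  set q : ℝ := 1 / (2 * (4 * d + 1)) with hq
  have hd' : (2 : ℝ) ≤ d := by exact_mod_cast hd
  have hq0 : 0 < q := by positivity
  have hq1 : q ≤ 1 / 2 := by
    rw [hq]; gcongr; linarith
  set η : ℝ := q ^ (1 / ε) with hη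
  have hη0 : 0 < η := Real.rpow_pos_of_pos hq0 _
  have hηq : η ≤ q := by
    have := Real.rpow_le_rpow_of_exponent_ge hq0 (by linarith) ((one_le_div hε0).2 hε1.le)
    rwa [Real.rpow_one] at this
  have hηε : 2 * ((4 * d + 1) * η) ≤ η ^ (1 - ε) := by
    have h1 : η ^ ε = q := by
      rw [hη, ← Real.rpow_mul hq0.le, one_div, inv_mul_cancel₀ hε0.ne', Real.rpow_one]
    have h2 : η = η ^ (1 - ε) * q := by
      rw [← h1, ← Real.rpow_add hη0, sub_add_cancel, Real.rpow_one]
    refine le_of_eq ?_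
    calc 2 * ((4 * d + 1) * η) = 2 * (4 * d + 1) * (η ^ (1 - ε) * q) := by rw [← h2]; ring
      _ = η ^ (1 - ε) := by rw [hq]; field_simp
  have key : ∀ κ : ℝ, 0 < κ → ∃ M : ℝ, 0 < M ∧ ∀ Ω : Set (EuclideanSpace ℝ (Fin d)), IsOpen Ω →
      ∀ R₀ Rinf : ℝ, R₀ / Rinf = κ → HarmonicDecay.TERWith Ω (η / 2) R₀ Rinf →
        HarmonicDecay.LHMDWith Ω (1 - ε) M := fun κ hκ => by
    obtain ⟨N, hN⟩ := exists_pow_lt_of_lt_one hκ (by linarith : η < 1)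
    exact ⟨(2 / η ^ (1 - ε)) ^ N / η ^ (1 - ε), by positivity, fun Ω hΩ R₀ Rinf hR hT =>
      HarmonicDecay.LHMDWith_of_TERWith (by omega) hε1 hη0 (by linarith) hηε hκ hN.le hΩ hR hT⟩
  refine ⟨η / 2, by positivity, by linarith, fun Ω hΩ _ ⟨R₀, Rinf, hT⟩ => ?_, fun κ hκ => ?_⟩
  · obtain ⟨M, hM, h⟩ := key (R₀ / Rinf) (div_pos hT.1 (hT.1.trans_le hT.2.1))
    exact ⟨M, hM, h Ω hΩ R₀ Rinf rfl hT⟩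
  · obtain ⟨M, hM, h⟩ := key κ hκ.1
    exact ⟨M, hM, fun Ω hΩ _ => h Ω hΩ⟩
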